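/- Let $V$ be a countable set of propositional variables, and let formulas be built from $V$ and $\bot$ with the binary connectives $\wedge,\to$ and the unary connective $\sim$. Put $\neg\varphi:=\varphi\to\bot$, $\varphi\leftrightarrow\psi:=(\varphi\to\psi)\wedge(\psi\to\varphi)$ and $\Delta\varphi:=\neg{\sim}\varphi$. An evaluation $e$ maps formulas to $[0,1]$ so that $e(\bot)=0$, $e(\varphi\wedge\psi)=\min(e(\varphi),e(\psi))$, $e(\sim\varphi)=1-e(\varphi)$, and $e(\varphi\to\psi)=1$ if $e(\varphi)\le e(\psi)$ and $e(\varphi\to\psi)=e(\psi)$ otherwise. For $F\subseteq[0,1]$ and any set of formulas $\Gamma\cup\{\varphi\}$, write $\Gamma\vdash_F\varphi$ if, for every evaluation $e$ with $e(\gamma)\in F$ for all $\gamma\in\Gamma$, one has $e(\varphi)\in F$. Let $\vdash_1,\vdash_{(1/2},\vdash_{[1/2},\vdash_{(0}$ be $\vdash_F$ for $F=\{1\},(1/2,1],[1/2,1],(0,1]$, respectively. The finitary companion $\vdash^f$ of $\vdash$ is defined by: $\Gamma\vdash^f\varphi$ iff $\Gamma_0\vdash\varphi$ for some finite $\Gamma_0\subseteq\Gamma$;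 and $\vdash$ is finitary if $\Gamma\vdash\varphi$ always implies $\Gamma\vdash^f\varphi$. A translation is a finite set $\tau$ of formulas $t(p)$ in one variable $p$; put $\tau(\varphi)=\{t(\varphi):t\in\tau\}$ and $\tau(\Gamma)=\bigcup_{\gamma\in\Gamma}\tau(\gamma)$. Logics $\vdash$ and $\vdash'$ are equivalent (as deductive systems, in the sense of Blok and Pigozzi) via translations $\tau,\rho$ if for all $\Gamma,\varphi$: $\Gamma\vdash\varphi$ iff $\tau(\Gamma)\vdash'\tau(\varphi)$; $\Gamma\vdash'\varphi$ iff $\rho(\Gamma)\vdash\rho(\varphi)$; $\varphi\dashv\vdash\rho(\tau(\varphi))$; and $\varphi\dashv\vdash'\tau(\rho(\varphi))$. Here a set of formulas on the right-hand side means that each of its members is derivable. **Lemma.** The logic $\vdash_1$ is finitary. Moreover, $\vdash_{(1/2}$, $\vdash_{[1/2}$ and $\vdash_{(0}$ are each equivalent to $\vdash_1$ as deductive systems, via the translations $$\{({\sim}p\to p)\wedge\neg\Delta(p\leftrightarrow{\sim}p)\},\qquad \{{\sim}p\to p\},\qquad \{\neg\neg p\},$$ respectively, into $\vdash_1$, with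 $\{\Delta p\}$ as the converse translation in all three cases. Hence these three logics are finitary as well, and each of the four logics $\vdash_1,\vdash_{(1/2},\vdash_{[1/2},\vdash_{(0}$ coincides with its finitary companion. -/

import Mathlib

/-! Gödel logic with an involutive negation: syntax, the standard algebra on `[0,1]`,
matrix logics given by order filters, finitarity and equivalence of deductive systems. -/

namespace GodelInv

universe u

/-- Formulas over the set `V` of propositional variables, in the primitive connectives
`⊥`, `∧`, `→` and the involutive negation `∼` (here `inv`). -/
inductive Fm (V : Type u) : Type u
  | var (v : V) : Fm V
  | bot : Fm V
  | and (φ ψ : Fm V) : Fm V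
  | imp (φ ψ : Fm V) : Fm V
  | inv (φ : Fm V) : Fm V

namespace Fm

variable {V W : Type*}

/-- Gödel negation `¬φ := φ → ⊥`. -/
def neg (φ : Fm V) : Fm V := imp φ bot

/-- `φ ↔ ψ := (φ → ψ) ∧ (ψ → φ)`. -/
def iff (φ ψ : Fm V) : Fm V := and (imp φ ψ) (imp ψ φ)

/-- The Monteiro–Baaz connective `Δφ := ¬∼φ`. -/
def delta (φ : Fm V) : Fm V := neg (inv φ)

/-- `(∼φ → φ) ∧ ¬Δ(φ ↔ ∼φ)`. -/
def star₁ (φ : Fm V) : Fm V := and (imp (inv φ) φ) (neg (delta (iff φ (inv φ))))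

/-- `∼φ → φ`. -/
def star₂ (φ : Fm V) : Fm V := imp (inv φ) φ

/-- `¬¬φ`. -/
def star₃ (φ : Fm V) : Fm V := neg (neg φ)

/-- Simultaneous substitution of formulas for variables. -/
def subst (s : V → Fm W) : Fm V → Fm W
  | var v => s v
  | bot => bot
  | and φ ψ => and (subst s φ) (subst s ψ)
  | imp φ ψ => imp (subst s φ) (subst s ψ)
  | inv φ => inv (subst s φ)

end Fm

/-- Gödel implication on the real unit interval. -/
noncomputable def gImp (x y : unitInterval) : unitInterval :=
  open Classical in if x ≤ y then 1 else y

/-- The value of a formula in the standard algebra `[0,1]` (minimum, Gödel implication, `0`, and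
the involution `x ↦ 1 - x`) under the evaluation determined by the values `e` of the variables. -/
noncomputable def eval {V : Type*} (e : V → unitInterval) : Fm V → unitInterval
  | .var v => e v
  | .bot => 0
  | .and φ ψ => min (eval e φ) (eval e ψ)
  | .imp φ ψ => gImp (eval e φ) (eval e ψ)
  | .inv φ => unitInterval.symm (eval e φ)

theorem eval_subst {V W : Type*} (e : W → unitInterval) (s : V → Fm W) (φ : Fm V) :
    eval e (φ.subst s) = eval (fun v => eval e (s v)) φ := by
  induction φ with
  | var v => rfl
  | bot => rfl
  | and φ ψ ih₁ ih₂ => simp only [Fm.subst, eval, ih₁, ih₂]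
  | imp φ ψ ih₁ ih₂ => simp only [Fm.subst, eval, ih₁, ih₂]
  | inv φ ih => simp only [Fm.subst, eval, ih]

/-- A (not necessarily finitary) deductive system: a structural (substitution-invariant)
consequence relation on formulas over `V`. -/
@[ext]
structure DeductiveSystem (V : Type u) where
  Entails : Set (Fm V) → Fm V → Prop
  of_mem : ∀ {Γ : Set (Fm V)} {φ : Fm V}, φ ∈ Γ → Entails Γ φ
  cut : ∀ {Γ Θ : Set (Fm V)} {φ : Fm V}, (∀ ψ ∈ Θ, Entails Γ ψ) → Entails Θ φ → Entails Γ φ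
  structural : ∀ {Γ : Set (Fm V)} {φ : Fm V} (s : V → Fm V),
    Entails Γ φ → Entails (Fm.subst s '' Γ) (φ.subst s)

namespace DeductiveSystem

variable {V : Type*}

/-- Every consequence already follows from finitely many of the premises. -/
def Finitary (L : DeductiveSystem V) : Prop :=
  ∀ (Γ : Set (Fm V)) (φ : Fm V), L.Entails Γ φ → ∃ Γ₀ ⊆ Γ, Γ₀.Finite ∧ L.Entails Γ₀ φ

/-- The finitary companion: `φ` follows from `Γ` iff in `L` it follows from a finite subset
of `Γ`. -/
def finitaryCompanion (L : DeductiveSystem V) : DeductiveSystem V where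
  Entails Γ φ := ∃ Γ₀ ⊆ Γ, Γ₀.Finite ∧ L.Entails Γ₀ φ
  of_mem {Γ φ} h := ⟨{φ}, by simpa using h, Set.finite_singleton φ, L.of_mem rfl⟩
  cut {Γ Θ φ} h := by
    rintro ⟨Θ₀, hsub, hfin, hφ⟩
    choose! F hF using h
    refine ⟨⋃ ψ ∈ Θ₀, F ψ, ?_, ?_, ?_⟩
    · exact Set.iUnion₂_subset fun ψ hψ => (hF ψ (hsub hψ)).1
    · exact hfin.biUnion fun ψ hψ => (hF ψ (hsub hψ)).2.1
    · refine L.cut (fun ψ hψ => ?_) hφ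
      exact L.cut (fun χ hχ => L.of_mem (Set.mem_biUnion hψ hχ)) (hF ψ (hsub hψ)).2.2
  structural {Γ φ} s := by
    rintro ⟨Γ₀, hsub, hfin, hφ⟩
    exact ⟨_, Set.image_mono hsub, hfin.image _, L.structural s hφ⟩

end DeductiveSystem

/-- The logic of the matrix consisting of the standard algebra on `[0,1]` and the set `F` of
designated values. -/
noncomputable def matrixLogic (V : Type*) (F : Set unitInterval) : DeductiveSystem V where
  Entails Γ φ := ∀ e : V → unitInterval, (∀ γ ∈ Γ, eval e γ ∈ F) → eval e φ ∈ F
  of_mem h _ he := he _ h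
  cut h hφ e he := hφ e fun ψ hψ => h ψ hψ e he
  structural s h e he := by
    rw [eval_subst]
    refine h _ fun γ hγ => ?_
    rw [← eval_subst]
    exact he _ (Set.mem_image_of_mem _ hγ)

/-- The logic with set of designated values `[a,1]`. -/
noncomputable def closedLogic (V : Type*) (a : ℝ) : DeductiveSystem V :=
  matrixLogic V {x | a ≤ (x : ℝ)}

/-- The logic with set of designated values `(a,1]`. -/
noncomputable def openLogic (V : Type*) (a : ℝ) : DeductiveSystem V :=
  matrixLogic V {x | a < (x : ℝ)}

/-- A translation is a finite set of formulas in one variable. -/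
abbrev Translation : Type := Finset (Fm Unit)

namespace Translation

variable {V : Type*}

/-- The set of translations of a formula: all `t(φ)` with `t(p)` in the translation. -/
def formula (τ : Translation) (φ : Fm V) : Set (Fm V) :=
  {ψ | ∃ t ∈ τ, ψ = Fm.subst (fun _ => φ) t}

/-- The translation of a set of formulas. -/
def theory (τ : Translation) (Γ : Set (Fm V)) : Set (Fm V) :=
  ⋃ γ ∈ Γ, τ.formula γ

/-- The translation that consists of the single formula `c(p)`. -/
def single (c : Fm Unit → Fm Unit) : Translation := {c (Fm.var ())}

end Translation

namespace DeductiveSystem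

variable {V : Type*}

/-- `Γ` entails every member of `Θ`. -/
def EntailsAll (L : DeductiveSystem V) (Γ Θ : Set (Fm V)) : Prop := ∀ θ ∈ Θ, L.Entails Γ θ

/-- Equivalence of deductive systems in the sense of Blok and Pigozzi, witnessed by the
translations `τ` from `L` to `L'` and `ρ` from `L'` to `L`: both are faithful interpretations, and
they are inverse to each other up to interderivability. -/
structure EquivalentVia (L L' : DeductiveSystem V) (τ ρ : Translation) : Prop where
  left_interp : ∀ (Γ : Set (Fm V)) (φ : Fm V),
    L.Entails Γ φ ↔ L'.EntailsAll (τ.theory Γ) (τ.formula φ)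
  right_interp : ∀ (Γ : Set (Fm V)) (φ : Fm V),
    L'.Entails Γ φ ↔ L.EntailsAll (ρ.theory Γ) (ρ.formula φ)
  left_inverse : ∀ φ : Fm V,
    L.EntailsAll {φ} (ρ.theory (τ.formula φ)) ∧ L.Entails (ρ.theory (τ.formula φ)) φ
  right_inverse : ∀ φ : Fm V,
    L'.EntailsAll {φ} (τ.theory (ρ.formula φ)) ∧ L'.Entails (τ.theory (ρ.formula φ)) φ

end DeductiveSystem

end GodelInv

/-! The Gödel operations are determined by the order and the constants 0 and 1, and `∼` is an
order-reversing involution. If no finite part of Γ entails φ, an ultraproduct of countermodels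
satisfies Γ and refutes φ. Only countably many of its elements are values of formulas, so these
embed in ℚ, and averaging with the reflected order turns `∼` into `x ↦ 1 - x`. The result is a
countermodel in `[0,1]` (`exists_eval_le_iff_eventually`), so the logic of `{1}` is finitary.

For the other three logics, membership in the designated set is expressed by a formula taking value
1, while `Δ` sends 1 to 1 and everything else to 0. The equivalences are then checked pointwise, and
finitarity is pulled back along them. -/

namespace GodelInv

open Filter

/-! ### Countability of the set of formulas -/

namespace Fm

variable {V : Type*}

/-- Gödel numbering of formulas induced by a numbering of the variables. -/
def code (f : V → ℕ) : Fm V → ℕ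
  | var v => 5 * f v
  | bot => 1
  | and φ ψ => 5 * Nat.pair (code f φ) (code f ψ) + 2
  | imp φ ψ => 5 * Nat.pair (code f φ) (code f ψ) + 3
  | inv φ => 5 * code f φ + 4

theorem code_injective {f : V → ℕ} (hf : Function.Injective f) :
    Function.Injective (code f) := by
  intro φ
  induction φ with
  | var v =>
    intro ψ h
    -- Codes of different constructors differ modulo 5.
    cases ψ <;> simp only [code] at h <;> first | omega | skip
    rw [hf (Nat.eq_of_mul_eq_mul_left (by norm_num : 0 < 5) h)]
  | bot =>
    intro ψ h
    cases ψ <;> simp only [code] at h <;> first | omega | rfl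
  | and φ₁ φ₂ ih₁ ih₂ =>
    intro ψ h
    cases ψ <;> simp only [code] at h <;> first | omega | skip
    obtain ⟨h₁, h₂⟩ := Nat.pair_eq_pair.1
      (Nat.eq_of_mul_eq_mul_left (by norm_num : 0 < 5) (Nat.add_right_cancel h))
    rw [ih₁ h₁, ih₂ h₂]
  | imp φ₁ φ₂ ih₁ ih₂ =>
    intro ψ h
    cases ψ <;> simp only [code] at h <;> first | omega | skip
    obtain ⟨h₁, h₂⟩ := Nat.pair_eq_pair.1
      (Nat.eq_of_mul_eq_mul_left (by norm_num : 0 < 5) (Nat.add_right_cancel h))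
    rw [ih₁ h₁, ih₂ h₂]
  | inv φ ih =>
    intro ψ h
    cases ψ <;> simp only [code] at h <;> first | omega | skip
    rw [ih (Nat.eq_of_mul_eq_mul_left (by norm_num : 0 < 5) (Nat.add_right_cancel h))]

instance [Countable V] : Countable (Fm V) := by
  obtain ⟨f, hf⟩ := exists_injective_nat V
  exact (code_injective hf).countable

end Fm

/-! ### Truth conditions in the standard algebra -/

section Eval

variable {V : Type*} (e : V → unitInterval)

theorem gImp_of_le {x y : unitInterval} (h : x ≤ y) : gImp x y = 1 := if_pos h

theorem gImp_of_lt {x y : unitInterval} (h : y < x) : gImp x y = y := if_neg h.not_ge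

theorem gImp_eq_one_iff {x y : unitInterval} : gImp x y = 1 ↔ x ≤ y := by
  refine ⟨fun h => ?_, gImp_of_le⟩
  by_contra! hlt
  rw [gImp_of_lt hlt] at h
  exact (hlt.trans_le unitInterval.le_one').ne h

theorem eval_neg_eq_one_iff (φ : Fm V) : eval e φ.neg = 1 ↔ eval e φ = 0 :=
  gImp_eq_one_iff.trans (le_antisymm_iff.trans (and_iff_left unitInterval.nonneg')).symm

theorem eval_neg_eq_zero_iff (φ : Fm V) : eval e φ.neg = 0 ↔ eval e φ ≠ 0 := by
  refine ⟨fun h h0 => ?_, fun h => gImp_of_lt (unitInterval.pos_iff_ne_zero.2 h)⟩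
  rw [(eval_neg_eq_one_iff e φ).2 h0] at h
  exact one_ne_zero h

theorem eval_delta_eq_one_iff (φ : Fm V) : eval e φ.delta = 1 ↔ eval e φ = 1 :=
  (eval_neg_eq_one_iff e _).trans unitInterval.symm_eq_zero

theorem eval_delta_eq_zero_iff (φ : Fm V) : eval e φ.delta = 0 ↔ eval e φ ≠ 1 :=
  (eval_neg_eq_zero_iff e _).trans unitInterval.symm_eq_zero.not

theorem eval_and_eq_one_iff (φ ψ : Fm V) :
    eval e (φ.and ψ) = 1 ↔ eval e φ = 1 ∧ eval e ψ = 1 := by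
  rw [eval, ← unitInterval.le_one'.ge_iff_eq, le_min_iff, unitInterval.le_one'.ge_iff_eq,
    unitInterval.le_one'.ge_iff_eq]

theorem eval_iff_eq_one_iff (φ ψ : Fm V) : eval e (φ.iff ψ) = 1 ↔ eval e φ = eval e ψ := by
  rw [Fm.iff, eval_and_eq_one_iff, le_antisymm_iff (a := eval e φ)]
  exact and_congr gImp_eq_one_iff gImp_eq_one_iff

theorem eval_star₂_eq_one_iff (φ : Fm V) : eval e φ.star₂ = 1 ↔ 1 / 2 ≤ (eval e φ : ℝ) := by
  refine gImp_eq_one_iff.trans ?_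
  rw [← Subtype.coe_le_coe, eval, unitInterval.coe_symm_eq]
  constructor <;> intro h <;> linarith

theorem eval_star₁_eq_one_iff (φ : Fm V) : eval e φ.star₁ = 1 ↔ 1 / 2 < (eval e φ : ℝ) := by
  -- The only fixed point of the involution is 1/2, so the second conjunct of `star₁` excludes
  -- exactly this value.
  have h : eval e φ = eval e φ.inv ↔ (eval e φ : ℝ) = 1 / 2 := by
    rw [← Subtype.coe_inj, eval, unitInterval.coe_symm_eq]
    constructor <;> intro h <;> linarith
  rw [Fm.star₁, eval_and_eq_one_iff, eval_neg_eq_one_iff, eval_delta_eq_zero_iff, Ne,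
    eval_iff_eq_one_iff, h, lt_iff_le_and_ne, ne_comm]
  exact and_congr (eval_star₂_eq_one_iff e φ) Iff.rfl

theorem eval_star₃_eq_one_iff (φ : Fm V) : eval e φ.star₃ = 1 ↔ 0 < (eval e φ : ℝ) := by
  rw [Fm.star₃, eval_neg_eq_one_iff, eval_neg_eq_zero_iff, ← unitInterval.pos_iff_ne_zero]
  rfl

end Eval

/-! ### Compactness by ultraproducts -/

section Compactness

variable {V : Type*}

/-- A map into `[0,1]` that reflects the order induced by an ultrapower of the standard algebra
and commutes with `⊥` and `∼` is an evaluation. -/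
theorem eval_eq_of_le_iff_eventually {ι : Type*} (U : Ultrafilter ι) (e : ι → V → unitInterval)
    (f : Fm V → unitInterval)
    (hle : ∀ φ ψ, f φ ≤ f ψ ↔ ∀ᶠ i in U, eval (e i) φ ≤ eval (e i) ψ)
    (hbot : f .bot = 0) (hinv : ∀ φ, f φ.inv = unitInterval.symm (f φ)) (φ : Fm V) :
    eval (fun v => f (.var v)) φ = f φ := by
  have heq : ∀ {φ ψ}, (∀ᶠ i in U, eval (e i) φ = eval (e i) ψ) → f φ = f ψ := fun h =>
    le_antisymm ((hle _ _).2 (h.mono fun _ h => h.le)) ((hle _ _).2 (h.mono fun _ h => h.ge))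
  -- The top is the value of a formula, so the value 1 of a Gödel implication can be compared
  -- through `hle`.
  have htop : f (Fm.inv .bot) = 1 := by rw [hinv, hbot, unitInterval.symm_zero]
  induction φ with
  | var v => rfl
  | bot => exact hbot.symm
  | and φ ψ ih₁ ih₂ =>
    rw [eval, ih₁, ih₂]
    rcases le_total (f φ) (f ψ) with h | h
    · rw [min_eq_left h]
      exact heq (((hle _ _).1 h).mono fun i hi => (min_eq_left hi).symm)
    · rw [min_eq_right h]
      exact heq (((hle _ _).1 h).mono fun i hi => (min_eq_right hi).symm)
  | imp φ ψ ih₁ ih₂ =>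
    rw [eval, ih₁, ih₂]
    by_cases h : f φ ≤ f ψ
    · rw [gImp_of_le h, ← htop]
      exact heq (((hle _ _).1 h).mono fun i hi =>
        unitInterval.symm_zero.trans (gImp_of_le hi).symm)
    · rw [gImp_of_lt (not_le.1 h)]
      -- The ultrafilter turns the failure of `≤` into strict inequality almost everywhere, which
      -- fixes the other case of `gImp`.
      rw [hle, ← Ultrafilter.eventually_not] at h
      exact heq (h.mono fun i hi => (gImp_of_lt (not_le.1 hi)).symm)
  | inv φ ih => rw [eval, ih, hinv]

/-- Every ultraproduct of evaluations over a countable set of variables is represented, as far as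
the order is concerned, by a single evaluation in `[0,1]`. -/
theorem exists_eval_le_iff_eventually [Countable V] {ι : Type*} (U : Ultrafilter ι)
    (e : ι → V → unitInterval) :
    ∃ e' : V → unitInterval, ∀ φ ψ,
      eval e' φ ≤ eval e' ψ ↔ ∀ᶠ i in U, eval (e i) φ ≤ eval (e i) ψ := by
  let G : Fm V → Germ (U : Filter ι) unitInterval := fun φ => ↑(fun i => eval (e i) φ)
  have hG : ∀ φ ψ, G φ ≤ G ψ ↔ ∀ᶠ i in U, eval (e i) φ ≤ eval (e i) ψ := fun _ _ => Germ.coe_le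
  have : Countable (Set.range G) := (Set.countable_range G).to_subtype
  -- The values of formulas form a countable linear order, hence embed in ℚ; this embedding need not
  -- respect `∼`.
  obtain ⟨j⟩ := Order.embedding_from_countable_to_dense (Set.range G) ℚ
  let g : Fm V → ℝ := fun φ => (j ⟨G φ, φ, rfl⟩ : ℚ)
  have hg : ∀ φ ψ, g φ ≤ g ψ ↔ G φ ≤ G ψ := fun φ ψ =>
    Rat.cast_le.trans j.le_iff_le
  have hginv : ∀ φ ψ, g φ.inv ≤ g ψ.inv ↔ g ψ ≤ g φ := fun φ ψ => by
    simp only [hg, hG, eval, unitInterval.symm_le_symm]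
  have hginvinv : ∀ φ : Fm V, g φ.inv.inv = g φ := fun φ => by
    refine le_antisymm ?_ ?_ <;> simp [hg, hG, eval]
  have hbot : ∀ φ, g .bot ≤ g φ := fun φ => by simp [hg, hG, eval]
  have htop : ∀ φ, g φ ≤ g (Fm.inv .bot) := fun φ => by
    simp [hg, hG, eval, unitInterval.le_one']
  have hlt : g .bot < g (Fm.inv .bot) := by
    rw [← not_le, hg, hG]
    simp [eval, U.neBot.ne]
  obtain ⟨d, hd⟩ : ∃ d, d = g (Fm.inv .bot) - g .bot := ⟨_, rfl⟩
  have hd0 : 0 < d := by linarith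
  -- Since `∼` reverses the order, `g φ - g φ.inv` orders formulas as `g φ` does, and it changes
  -- sign under `∼`. It ranges over `[-d, d]`, which is rescaled affinely to `[0,1]`.
  let f : Fm V → unitInterval := fun φ => ⟨(d + g φ - g φ.inv) / (2 * d), by
    constructor
    · have := hbot φ
      have := htop φ.inv
      apply div_nonneg <;> linarith
    · have := htop φ
      have := hbot φ.inv
      rw [div_le_one (by linarith)]
      linarith⟩
  have hfle : ∀ φ ψ, f φ ≤ f ψ ↔ g φ ≤ g ψ := fun φ ψ => by
    have h₁ := hginv φ ψ
    have h₂ := hginv ψ φ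
    rw [← Subtype.coe_le_coe, div_le_div_iff_of_pos_right (by linarith)]
    constructor
    · intro h
      by_contra hn
      have := h₁.2 (not_le.1 hn).le
      linarith
    · intro h
      have := h₂.2 h
      linarith
  have hf : ∀ φ ψ, f φ ≤ f ψ ↔ ∀ᶠ i in U, eval (e i) φ ≤ eval (e i) ψ := fun φ ψ =>
    (hfle φ ψ).trans ((hg φ ψ).trans (hG φ ψ))
  have key := eval_eq_of_le_iff_eventually U e f hf
    (Subtype.ext (by simp [f, hd]))
    (fun φ => Subtype.ext (by
      rw [unitInterval.coe_symm_eq]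
      simp only [f, hginvinv]
      field_simp
      ring))
  exact ⟨fun v => f (.var v), fun φ ψ => by rw [key, key, hf]⟩

theorem closedLogic_one_finitary [Countable V] : (closedLogic V 1).Finitary := by
  -- Designation becomes an order comparison of two formulas, the kind of statement that the
  -- ultraproduct preserves.
  have hmem : ∀ (e : V → unitInterval) φ,
      eval e φ ∈ {x : unitInterval | (1 : ℝ) ≤ x} ↔ eval e (Fm.inv .bot) ≤ eval e φ := by
    intro e φ
    rw [eval, eval, unitInterval.symm_zero]
    rfl
  intro Γ φ h
  by_contra! hn
  have hS : ∀ S : Finset (Fm V), ∃ e : V → unitInterval,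
      (∀ γ ∈ Γ ∩ S, eval e (Fm.inv .bot) ≤ eval e γ) ∧ ¬ eval e (Fm.inv .bot) ≤ eval e φ := by
    intro S
    have := hn (Γ ∩ S) Set.inter_subset_left (S.finite_toSet.inter_of_right Γ)
    simp only [closedLogic, matrixLogic, hmem] at this
    push Not at this ⊢
    exact this
  choose e heΓ heφ using hS
  obtain ⟨e', he'⟩ := exists_eval_le_iff_eventually (Ultrafilter.of atTop) e
  -- Each γ in Γ holds at every index S containing γ, and the ultrafilter refines `atTop`, so the
  -- limit evaluation satisfies all of Γ.
  have hφ := h e' fun γ hγ => (hmem _ _).2 <| (he' _ _).2 <| Ultrafilter.of_le atTop <|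
    (eventually_ge_atTop {γ}).mono fun S hSγ =>
      heΓ S γ ⟨hγ, hSγ (Finset.mem_singleton_self γ)⟩
  obtain ⟨S, hS⟩ := ((he' _ _).1 ((hmem _ _).1 hφ)).exists
  exact heφ S hS

end Compactness

/-! ### Translations and transfer of finitarity -/

section Equivalence

variable {V : Type*}

namespace Translation

theorem formula_single (c : Fm Unit → Fm Unit) (φ : Fm V) :
    (single c).formula φ = {Fm.subst (fun _ => φ) (c (.var ()))} := by
  ext ψ
  simp [formula, single]

theorem theory_single (c : Fm Unit → Fm Unit) (Γ : Set (Fm V)) :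
    (single c).theory Γ = (fun φ => Fm.subst (fun _ => φ) (c (.var ()))) '' Γ := by
  simp only [theory, formula_single, Set.image_eq_iUnion]

theorem finite_formula (τ : Translation) (φ : Fm V) : (τ.formula φ).Finite :=
  (τ.finite_toSet.image fun t => Fm.subst (fun _ => φ) t).subset fun _ ⟨t, ht, h⟩ =>
    ⟨t, ht, h.symm⟩

end Translation

namespace DeductiveSystem

theorem Entails.mono {L : DeductiveSystem V} {Γ Θ : Set (Fm V)} {φ : Fm V} (h : L.Entails Γ φ)
    (hsub : Γ ⊆ Θ) : L.Entails Θ φ :=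
  L.cut (fun _ hψ => L.of_mem (hsub hψ)) h

theorem Finitary.eq_finitaryCompanion {L : DeductiveSystem V} (h : L.Finitary) :
    L = L.finitaryCompanion := by
  ext Γ φ
  exact ⟨h Γ φ, fun ⟨_, hsub, _, hφ⟩ => hφ.mono hsub⟩

/-- Finitarity is transported along an equivalence of deductive systems. -/
theorem EquivalentVia.finitary {L L' : DeductiveSystem V} {τ ρ : Translation}
    (h : L.EquivalentVia L' τ ρ) (hL' : L'.Finitary) : L.Finitary := by
  intro Γ φ hφ
  choose! F hFsub hFfin hF using fun θ hθ => hL' _ _ ((h.left_interp Γ φ).1 hφ θ hθ)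
  have hmem : ∀ ψ ∈ ⋃ θ ∈ τ.formula φ, F θ, ∃ γ ∈ Γ, ψ ∈ τ.formula γ := by
    intro ψ hψ
    obtain ⟨θ, hθ, hψ⟩ := Set.mem_iUnion₂.1 hψ
    obtain ⟨γ, hγ, hψγ⟩ := Set.mem_iUnion₂.1 (hFsub θ hθ hψ)
    exact ⟨γ, hγ, hψγ⟩
  -- Each translated premise in use gets one source in Γ; finitely many sources suffice because `τ`
  -- is finite.
  choose! g hgΓ hg using hmem
  refine ⟨g '' ⋃ θ ∈ τ.formula φ, F θ, ?_, ?_, ?_⟩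
  · rintro _ ⟨ψ, hψ, rfl⟩
    exact hgΓ ψ hψ
  · exact ((τ.finite_formula φ).biUnion hFfin).image g
  · refine (h.left_interp _ φ).2 fun θ hθ => (hF θ hθ).mono fun ψ hψ => ?_
    have hψ' := Set.mem_biUnion hθ hψ
    exact Set.mem_biUnion (Set.mem_image_of_mem g hψ') (hg ψ hψ')

end DeductiveSystem

/-- One-formula translations that carry the designated values of two matrices on `[0,1]` into each
other yield an equivalence of the matrix logics. -/
theorem matrixLogic_equivalentVia {F F' : Set unitInterval} {c d : Fm Unit → Fm Unit}
    (hc : ∀ e : Unit → unitInterval, eval e (c (.var ())) ∈ F' ↔ e () ∈ F)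
    (hd : ∀ e : Unit → unitInterval, eval e (d (.var ())) ∈ F ↔ e () ∈ F') :
    (matrixLogic V F).EquivalentVia (matrixLogic V F') (.single c) (.single d) := by
  -- A translated formula is designated exactly when the original is, at each evaluation, so all
  -- four conditions become tautologies.
  constructor <;> intros <;>
    simp [DeductiveSystem.EntailsAll, matrixLogic, Translation.theory_single,
      Translation.formula_single, eval_subst, hc, hd]

theorem mem_iff_eq_one {x : unitInterval} : x ∈ {x : unitInterval | (1 : ℝ) ≤ x} ↔ x = 1 :=
  ⟨fun h => le_antisymm unitInterval.le_one' h, fun h => h ▸ le_refl (1 : ℝ)⟩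

/-- `Δ` translates the logic of `{1}` into the logic of any `F` with `0 ∉ F` and `1 ∈ F`. -/
theorem matrixLogic_equivalentVia_closedLogic_one {F : Set unitInterval} (h0 : 0 ∉ F)
    (h1 : 1 ∈ F) {c : Fm Unit → Fm Unit}
    (hc : ∀ e : Unit → unitInterval, eval e (c (.var ())) = 1 ↔ e () ∈ F) :
    (matrixLogic V F).EquivalentVia (closedLogic V 1) (.single c) (.single Fm.delta) := by
  refine matrixLogic_equivalentVia (fun e => mem_iff_eq_one.trans (hc e)) fun e => ?_
  rw [mem_iff_eq_one]
  by_cases h : e () = 1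
  · rw [(eval_delta_eq_one_iff e (.var ())).2 h]
    exact iff_of_true h1 h
  · rw [(eval_delta_eq_zero_iff e (.var ())).2 h]
    exact iff_of_false h0 h

end Equivalence

end GodelInv

theorem mainTheorem11 (V : Type*) [Countable V] :
    (GodelInv.closedLogic V 1).Finitary ∧
    (GodelInv.openLogic V (1 / 2)).EquivalentVia (GodelInv.closedLogic V 1)
      (GodelInv.Translation.single GodelInv.Fm.star₁)
      (GodelInv.Translation.single GodelInv.Fm.delta) ∧
    (GodelInv.closedLogic V (1 / 2)).EquivalentVia (GodelInv.closedLogic V 1)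
      (GodelInv.Translation.single GodelInv.Fm.star₂)
      (GodelInv.Translation.single GodelInv.Fm.delta) ∧
    (GodelInv.openLogic V 0).EquivalentVia (GodelInv.closedLogic V 1)
      (GodelInv.Translation.single GodelInv.Fm.star₃)
      (GodelInv.Translation.single GodelInv.Fm.delta) ∧
    (GodelInv.openLogic V (1 / 2)).Finitary ∧
    (GodelInv.closedLogic V (1 / 2)).Finitary ∧
    (GodelInv.openLogic V 0).Finitary ∧
    GodelInv.closedLogic V 1 = (GodelInv.closedLogic V 1).finitaryCompanion ∧
    GodelInv.openLogic V (1 / 2) = (GodelInv.openLogic V (1 / 2)).finitaryCompanion ∧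
    GodelInv.closedLogic V (1 / 2) = (GodelInv.closedLogic V (1 / 2)).finitaryCompanion ∧
    GodelInv.openLogic V 0 = (GodelInv.openLogic V 0).finitaryCompanion := by
  have hfin := GodelInv.closedLogic_one_finitary (V := V)
  have h₁ : (GodelInv.openLogic V (1 / 2)).EquivalentVia (GodelInv.closedLogic V 1)
      (GodelInv.Translation.single GodelInv.Fm.star₁)
      (GodelInv.Translation.single GodelInv.Fm.delta) :=
    GodelInv.matrixLogic_equivalentVia_closedLogic_one (by norm_num) (by norm_num)
      fun e => GodelInv.eval_star₁_eq_one_iff e _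
  have h₂ : (GodelInv.closedLogic V (1 / 2)).EquivalentVia (GodelInv.closedLogic V 1)
      (GodelInv.Translation.single GodelInv.Fm.star₂)
      (GodelInv.Translation.single GodelInv.Fm.delta) :=
    GodelInv.matrixLogic_equivalentVia_closedLogic_one (by norm_num) (by norm_num)
      fun e => GodelInv.eval_star₂_eq_one_iff e _
  have h₃ : (GodelInv.openLogic V 0).EquivalentVia (GodelInv.closedLogic V 1)
      (GodelInv.Translation.single GodelInv.Fm.star₃)
      (GodelInv.Translation.single GodelInv.Fm.delta) :=
    GodelInv.matrixLogic_equivalentVia_closedLogic_one (by norm_num) (by norm_num)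
      fun e => GodelInv.eval_star₃_eq_one_iff e _
  exact ⟨hfin, h₁, h₂, h₃, h₁.finitary hfin, h₂.finitary hfin, h₃.finitary hfin,
    hfin.eq_finitaryCompanion, (h₁.finitary hfin).eq_finitaryCompanion,
    (h₂.finitary hfin).eq_finitaryCompanion, (h₃.finitary hfin).eq_finitaryCompanion⟩
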